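/- Let $(M, g_M, J)$ be a Kähler manifold, i.e. $M$ is a smooth manifold with a Riemannian metric $g_M$ and a smooth almost complex structure $J$ such that $g_M(JX,JY)=g_M(X,Y)$ and $\nabla J=0$, where $\nabla$ is the Levi-Civita connection of $g_M$. Let $(N,g_N)$ be a Riemannian manifold and let $F : M \to N$ be a surjective Riemannian submersion, i.e. a smooth submersion whose differential $F_*$ preserves the lengths of vectors in $(\ker F_*)^\perp$. Suppose that $F$ is a v-semi-slant submersion: $\mathcal D_1 \subset (\ker F_*)^\perp$ is a smooth distribution with $J(\mathcal D_1)=\mathcal D_1$ and, $\mathcal D_2$ denoting the orthogonal complement of $\mathcal D_1$ in $(\ker F_*)^\perp$, the angle between $JX$ and the space $(\mathcal D_2)_p$ has the same value $\theta$ for all $p\in M$ and all nonzero $X\in(\mathcal D_2)_p$. Let $\mathcal V$ and $\mathcal H$ be the orthogonal projections of $TM$ onto $\ker F_*$ and $(\ker F_*)^\perp$, let $P$ be the projection of $(\ker F_*)^\perp=\mathcal D_1\oplus\mathcal D_2$ onto $\mathcal D_1$, and for a vector field $Z$ with values in $(\ker F_*)^\perp$ put $BZ=\mathcal V JZ$ and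 $CZ=\mathcal H JZ$. For vector fields $X, Y$ on $M$ let $$\mathcal A_X Y=\mathcal H\nabla_{\mathcal HX}\mathcal VY+\mathcal V\nabla_{\mathcal HX}\mathcal HY .$$ Write $\Gamma(\mathcal D_2)$ for the smooth vector fields with values in $\mathcal D_2$, and call $\mathcal D_2$ integrable if $[X,Y]\in\Gamma(\mathcal D_2)$ for all $X,Y\in\Gamma(\mathcal D_2)$. **Lemma 3.7.** The slant distribution $\mathcal D_2$ is integrable if and only if, for all $X,Y\in\Gamma(\mathcal D_2)$, $$\mathcal A_XY=0\quad\text{and}\quad P\big((\mathcal A_XBY-\mathcal A_YBX)+\mathcal H(\nabla_XCY-\nabla_YCX)\big)=0 .$$ -/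

import Mathlib

open Bundle Manifold VectorField
open scoped ContDiff

noncomputable section

namespace VSemiSlant

set_option linter.unusedSectionVars false

section LeviCivita

variable {E : Type*} [NormedAddCommGroup E] [NormedSpace ℝ E] [FiniteDimensional ℝ E]
  {H : Type*} [TopologicalSpace H] {I : ModelWithCorners ℝ E H}
  {M : Type*} [TopologicalSpace M] [ChartedSpace H M] [IsManifold I ∞ M]
  [RiemannianBundle (fun x : M => TangentSpace I x)]
  [IsContMDiffRiemannianBundle I ∞ E (fun x : M => TangentSpace I x)]

instance (x : M) : FiniteDimensional ℝ (TangentSpace I x) :=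
  inferInstanceAs (FiniteDimensional ℝ E)

instance (x : M) : CompleteSpace (TangentSpace I x) := FiniteDimensional.complete ℝ _

/-- The right-hand side of the Koszul formula:
`2 g(∇_X Y, Z) = X g(Y, Z) + Y g(Z, X) - Z g(X, Y) + g([X, Y], Z) - g([Y, Z], X) + g([Z, X], Y)`. -/
def koszul (X Y Z : Π x : M, TangentSpace I x) (x : M) : ℝ :=
  d% (fun y => inner ℝ (Y y) (Z y)) x (X x) + d% (fun y => inner ℝ (Z y) (X y)) x (Y x)
    - d% (fun y => inner ℝ (X y) (Y y)) x (Z x)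
    + inner ℝ (mlieBracket I X Y x) (Z x) - inner ℝ (mlieBracket I Y Z x) (X x)
    + inner ℝ (mlieBracket I Z X x) (Y x)

theorem mdifferentiableAt_inner_field {X Y : Π x : M, TangentSpace I x} {x : M}
    (hX : MDiffAt (T% X) x) (hY : MDiffAt (T% Y) x) :
    MDiffAt (fun y => (inner ℝ (X y) (Y y) : ℝ)) x :=
  MDifferentiableAt.inner_bundle (IB := I) (F := E) (E := fun x : M => TangentSpace I x)
    (b := fun y => y) (v := X) (w := Y) hX hY

theorem koszul_tensorial_right {X Y : Π x : M, TangentSpace I x} {x : M}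
    (hX : MDiffAt (T% X) x) (hY : MDiffAt (T% Y) x) :
    TensorialAt I E (fun Z : Π x : M, TangentSpace I x => koszul X Y Z x) x where
  smul {f Z} hf hZ := by
    have e1 : (fun y => inner ℝ (Y y) ((f • Z) y)) = fun y => f y * inner ℝ (Y y) (Z y) := by
      ext y; simp [inner_smul_right]
    have e2 : (fun y => inner ℝ ((f • Z) y) (X y)) = fun y => f y * inner ℝ (Z y) (X y) := by
      ext y; simp [inner_smul_left]
    simp only [koszul, e1, e2]
    rw [mvfderiv_fun_mul hf (mdifferentiableAt_inner_field hY hZ), mvfderiv_fun_mul hf (mdifferentiableAt_inner_field hZ hX),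
      mlieBracket_smul_right hf hZ, mlieBracket_smul_left hf hZ]
    simp [inner_add_left, inner_smul_left, inner_smul_right, real_inner_comm]
    ring
  add {Z Z'} hZ hZ' := by
    have e1 : (fun y => inner ℝ (Y y) ((Z + Z') y))
        = fun y => inner ℝ (Y y) (Z y) + inner ℝ (Y y) (Z' y) := by
      ext y; simp [inner_add_right]
    have e2 : (fun y => inner ℝ ((Z + Z') y) (X y))
        = fun y => inner ℝ (Z y) (X y) + inner ℝ (Z' y) (X y) := by
      ext y; simp [inner_add_left]
    simp only [koszul, e1, e2]
    rw [mvfderiv_fun_add (mdifferentiableAt_inner_field hY hZ) (mdifferentiableAt_inner_field hY hZ'),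
      mvfderiv_fun_add (mdifferentiableAt_inner_field hZ hX) (mdifferentiableAt_inner_field hZ' hX),
      mlieBracket_add_right hZ hZ', mlieBracket_add_left hZ hZ']
    simp [inner_add_left, inner_add_right]
    ring

theorem koszul_tensorial_left {Y Z : Π x : M, TangentSpace I x} {x : M}
    (hY : MDiffAt (T% Y) x) (hZ : MDiffAt (T% Z) x) :
    TensorialAt I E (fun X : Π x : M, TangentSpace I x => koszul X Y Z x) x where
  smul {f X} hf hX := by
    have e1 : (fun y => inner ℝ ((f • X) y) (Y y)) = fun y => f y * inner ℝ (X y) (Y y) := by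
      ext y; simp [inner_smul_left]
    have e2 : (fun y => inner ℝ (Z y) ((f • X) y)) = fun y => f y * inner ℝ (Z y) (X y) := by
      ext y; simp [inner_smul_right]
    simp only [koszul, e1, e2]
    rw [mvfderiv_fun_mul hf (mdifferentiableAt_inner_field hX hY), mvfderiv_fun_mul hf (mdifferentiableAt_inner_field hZ hX),
      mlieBracket_smul_right hf hX, mlieBracket_smul_left hf hX]
    simp [inner_add_left, inner_smul_left, inner_smul_right, real_inner_comm]
    ring
  add {X X'} hX hX' := by
    have e1 : (fun y => inner ℝ ((X + X') y) (Y y))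
        = fun y => inner ℝ (X y) (Y y) + inner ℝ (X' y) (Y y) := by
      ext y; simp [inner_add_left]
    have e2 : (fun y => inner ℝ (Z y) ((X + X') y))
        = fun y => inner ℝ (Z y) (X y) + inner ℝ (Z y) (X' y) := by
      ext y; simp [inner_add_right]
    simp only [koszul, e1, e2]
    rw [mvfderiv_fun_add (mdifferentiableAt_inner_field hX hY) (mdifferentiableAt_inner_field hX' hY),
      mvfderiv_fun_add (mdifferentiableAt_inner_field hZ hX) (mdifferentiableAt_inner_field hZ hX'),
      mlieBracket_add_right hX hX', mlieBracket_add_left hX hX']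
    simp [inner_add_left, inner_add_right]
    ring

open Classical in
/-- The Levi-Civita covariant derivative of a field `Y`, given by the Koszul formula at the points
where `Y` is differentiable (and by the junk value `0` elsewhere). -/
def leviCivitaFun (Y : Π x : M, TangentSpace I x) (x : M) :
    TangentSpace I x →L[ℝ] TangentSpace I x :=
  if hY : MDiffAt (T% Y) x then
    (1 / 2 : ℝ) • 
      (((InnerProductSpace.toDual ℝ (TangentSpace I x)).symm.toLinearIsometry.toContinuousLinearMap :
      (TangentSpace I x →L[ℝ] ℝ) →L[ℝ] TangentSpace I x)).comp
      (TensorialAt.mkHom₂ (fun X Z : Π x : M, TangentSpace I x => koszul X Y Z x) x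
        (fun _ hZ => koszul_tensorial_left hY hZ) (fun _ hX => koszul_tensorial_right hX hY))
  else 0

theorem inner_leviCivitaFun {X Y Z : Π x : M, TangentSpace I x} {x : M}
    (hX : MDiffAt (T% X) x) (hY : MDiffAt (T% Y) x) (hZ : MDiffAt (T% Z) x) :
    inner ℝ (leviCivitaFun Y x (X x)) (Z x) = koszul X Y Z x / 2 := by
  have h := TensorialAt.mkHom₂_apply (Φ := fun X Z : Π x : M, TangentSpace I x => koszul X Y Z x)
    (fun _ hZ => koszul_tensorial_left hY hZ) (fun _ hX => koszul_tensorial_right hX hY) hX hZ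
  simp only [leviCivitaFun, dif_pos hY, smul_apply,
    ContinuousLinearMap.comp_apply, inner_smul_left]
  rw [← h]
  refine (congrArg _ (InnerProductSpace.toDual_symm_apply (𝕜 := ℝ) (x := Z x))).trans ?_
  simp
  ring

theorem ext_inner_field {x : M} {v w : TangentSpace I x}
    (h : ∀ Z : Π x : M, TangentSpace I x, MDiffAt (T% Z) x → inner ℝ v (Z x) = inner ℝ w (Z x)) :
    v = w := by
  refine ext_inner_right ℝ fun z => ?_
  simpa using h (FiberBundle.extend E z) (FiberBundle.mdifferentiableAt_extend ..)

theorem leviCivitaFun_isCovariantDerivativeOn :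
    IsCovariantDerivativeOn E (leviCivitaFun (I := I) (M := M)) where
  add {Y Y' x} hY hY' _ := by
    ext v
    obtain ⟨X, hX, rfl⟩ : ∃ X : Π x : M, TangentSpace I x, MDiffAt (T% X) x ∧ X x = v :=
      ⟨FiberBundle.extend E v, FiberBundle.mdifferentiableAt_extend .., by simp⟩
    refine ext_inner_field fun Z hZ => ?_
    have hYY' : MDiffAt (T% (Y + Y')) x := mdifferentiableAt_add_section hY hY'
    rw [add_apply, inner_add_left, inner_leviCivitaFun hX hYY' hZ,
      inner_leviCivitaFun hX hY hZ, inner_leviCivitaFun hX hY' hZ]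
    have e1 : (fun y => inner ℝ ((Y + Y') y) (Z y))
        = fun y => inner ℝ (Y y) (Z y) + inner ℝ (Y' y) (Z y) := by
      ext y; simp [inner_add_left]
    have e2 : (fun y => inner ℝ (X y) ((Y + Y') y))
        = fun y => inner ℝ (X y) (Y y) + inner ℝ (X y) (Y' y) := by
      ext y; simp [inner_add_right]
    simp only [koszul, e1, e2]
    rw [mvfderiv_fun_add (mdifferentiableAt_inner_field hY hZ) (mdifferentiableAt_inner_field hY' hZ),
      mvfderiv_fun_add (mdifferentiableAt_inner_field hX hY) (mdifferentiableAt_inner_field hX hY'),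
      mlieBracket_add_right hY hY', mlieBracket_add_left hY hY']
    simp [inner_add_left, inner_add_right]
    ring
  leibniz {Y f x} hY hf _ := by
    ext v
    obtain ⟨X, hX, rfl⟩ : ∃ X : Π x : M, TangentSpace I x, MDiffAt (T% X) x ∧ X x = v :=
      ⟨FiberBundle.extend E v, FiberBundle.mdifferentiableAt_extend .., by simp⟩
    refine ext_inner_field fun Z hZ => ?_
    have hfY : MDiffAt (T% (f • Y)) x := hf.smul_section hY
    rw [add_apply, inner_add_left, inner_leviCivitaFun hX hfY hZ, smul_apply,
      inner_smul_left, inner_leviCivitaFun hX hY hZ]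
    have e1 : (fun y => inner ℝ ((f • Y) y) (Z y)) = fun y => f y * inner ℝ (Y y) (Z y) := by
      ext y; simp [inner_smul_left]
    have e2 : (fun y => inner ℝ (X y) ((f • Y) y)) = fun y => f y * inner ℝ (X y) (Y y) := by
      ext y; simp [inner_smul_right]
    simp only [koszul, e1, e2]
    rw [mvfderiv_fun_mul hf (mdifferentiableAt_inner_field hY hZ),
      mvfderiv_fun_mul hf (mdifferentiableAt_inner_field hX hY),
      mlieBracket_smul_right hf hY, mlieBracket_smul_left hf hY]
    simp [inner_add_left, inner_smul_left, inner_smul_right, real_inner_comm]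
    ring

variable (I M) in
/-- The Levi-Civita connection of the Riemannian manifold `M`; `leviCivita I M Y x (X x)` is
`∇_X Y` at `x`. -/
def leviCivita : CovariantDerivative I E (fun x : M => TangentSpace I x) where
  toFun := leviCivitaFun
  isCovariantDerivativeOnUniv := leviCivitaFun_isCovariantDerivativeOn

/-- `∇_X Y` for the Levi-Civita connection `∇`. -/
def nabla (X Y : Π x : M, TangentSpace I x) (x : M) : TangentSpace I x :=
  leviCivita I M Y x (X x)

/-- The Levi-Civita connection is torsion-free. -/
theorem leviCivita_torsionFree {X Y : Π x : M, TangentSpace I x} {x : M}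
    (hX : MDiffAt (T% X) x) (hY : MDiffAt (T% Y) x) :
    nabla X Y x - nabla Y X x = mlieBracket I X Y x := by
  refine ext_inner_field fun Z hZ => ?_
  change inner ℝ (leviCivitaFun Y x (X x) - leviCivitaFun X x (Y x)) (Z x) = _
  rw [inner_sub_left, inner_leviCivitaFun hX hY hZ, inner_leviCivitaFun hY hX hZ]
  simp only [koszul, mlieBracket_swap_apply (V := Y) (W := X),
    mlieBracket_swap_apply (V := Z) (W := X), mlieBracket_swap_apply (V := Z) (W := Y),
    real_inner_comm, inner_neg_left]
  ring

/-- The Levi-Civita connection is compatible with the metric. -/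
theorem leviCivita_metric {X Y Z : Π x : M, TangentSpace I x} {x : M}
    (hX : MDiffAt (T% X) x) (hY : MDiffAt (T% Y) x) (hZ : MDiffAt (T% Z) x) :
    d% (fun y => inner ℝ (Y y) (Z y)) x (X x)
      = inner ℝ (nabla X Y x) (Z x) + inner ℝ (Y x) (nabla X Z x) := by
  rw [real_inner_comm (nabla X Z x) (Y x)]
  change _ = inner ℝ (leviCivitaFun Y x (X x)) (Z x) + inner ℝ (leviCivitaFun Z x (X x)) (Y x)
  rw [inner_leviCivitaFun hX hY hZ, inner_leviCivitaFun hX hZ hY]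
  simp only [koszul, mlieBracket_swap_apply (V := Y) (W := X),
    mlieBracket_swap_apply (V := Z) (W := X), mlieBracket_swap_apply (V := Z) (W := Y),
    real_inner_comm, inner_neg_left]
  ring

end LeviCivita

section Distributions

variable {E : Type*} [NormedAddCommGroup E] [NormedSpace ℝ E]
  {H : Type*} [TopologicalSpace H] {I : ModelWithCorners ℝ E H}
  {M : Type*} [TopologicalSpace M] [ChartedSpace H M] [IsManifold I ∞ M]

/-- `D` is a smooth distribution, i.e. a smooth vector subbundle of the tangent bundle: near every
point it is spanned by a frame of smooth vector fields. -/
def IsSmoothDistribution (D : Π x : M, Submodule ℝ (TangentSpace I x)) : Prop :=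
  ∀ x₀ : M, ∃ U : Set M, IsOpen U ∧ x₀ ∈ U ∧
    ∃ (k : ℕ) (s : Fin k → Π x : M, TangentSpace I x),
      (∀ i, ContMDiffOn I I.tangent ∞ (fun x => (s i x : TangentBundle I M)) U) ∧
      ∀ x ∈ U, LinearIndependent ℝ (fun i => s i x) ∧
        Submodule.span ℝ (Set.range fun i => s i x) = D x

/-- `X ∈ Γ(D)`: `X` is a (global) smooth vector field with values in `D`. -/
structure IsSectionOf (X : Π x : M, TangentSpace I x)
    (D : Π x : M, Submodule ℝ (TangentSpace I x)) : Prop where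
  smooth : ContMDiff I I.tangent ∞ (fun x => (X x : TangentBundle I M))
  mem : ∀ x, X x ∈ D x

/-- `D` is integrable: `[X, Y] ∈ Γ(D)` for all `X, Y ∈ Γ(D)`. (The bracket of smooth vector fields
is smooth, so only the values of `[X, Y]` matter.) -/
def IsIntegrable (D : Π x : M, Submodule ℝ (TangentSpace I x)) : Prop :=
  ∀ X Y : Π x : M, TangentSpace I x, IsSectionOf X D → IsSectionOf Y D →
    ∀ x, mlieBracket I X Y x ∈ D x

end Distributions

section Hermitian

variable {E : Type*} [NormedAddCommGroup E] [NormedSpace ℝ E] [FiniteDimensional ℝ E]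
  {H : Type*} [TopologicalSpace H] {I : ModelWithCorners ℝ E H}
  {M : Type*} [TopologicalSpace M] [ChartedSpace H M] [IsManifold I ∞ M]
  [RiemannianBundle (fun x : M => TangentSpace I x)]
  [IsContMDiffRiemannianBundle I ∞ E (fun x : M => TangentSpace I x)]

/-- `J` is a smooth almost complex structure on `M` which is orthogonal for the metric of `M`,
i.e. `(M, g, J)` is an almost Hermitian manifold. -/
structure IsAlmostHermitian (J : Π x : M, TangentSpace I x →L[ℝ] TangentSpace I x) : Prop where
  smooth : ContMDiff I (I.prod 𝓘(ℝ, E →L[ℝ] E)) ∞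
    (fun x => TotalSpace.mk' (E →L[ℝ] E)
      (E := fun x : M => TangentSpace I x →L[ℝ] TangentSpace I x) x (J x))
  sq : ∀ (x : M) (v : TangentSpace I x), J x (J x v) = -v
  inner_map : ∀ (x : M) (v w : TangentSpace I x), inner ℝ (J x v) (J x w) = inner ℝ v w

/-- `(M, g, J)` is a Kähler manifold: it is almost Hermitian and `∇ J = 0`, i.e.
`∇_X (J Y) = J (∇_X Y)` for all smooth vector fields `X`, `Y`. -/
structure IsKahler (J : Π x : M, TangentSpace I x →L[ℝ] TangentSpace I x) : Prop
    extends IsAlmostHermitian J where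
  parallel : ∀ X Y : Π x : M, TangentSpace I x,
    ContMDiff I I.tangent ∞ (fun x => (X x : TangentBundle I M)) →
    ContMDiff I I.tangent ∞ (fun x => (Y x : TangentBundle I M)) →
    ∀ x, nabla X (fun y => J y (Y y)) x = J x (nabla X Y x)

end Hermitian

section Submersions

variable {E : Type*} [NormedAddCommGroup E] [NormedSpace ℝ E] [FiniteDimensional ℝ E]
  {H : Type*} [TopologicalSpace H] (I : ModelWithCorners ℝ E H)
  {M : Type*} [TopologicalSpace M] [ChartedSpace H M] [IsManifold I ∞ M]
  [RiemannianBundle (fun x : M => TangentSpace I x)]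
  [IsContMDiffRiemannianBundle I ∞ E (fun x : M => TangentSpace I x)]
  {E' : Type*} [NormedAddCommGroup E'] [NormedSpace ℝ E']
  {H' : Type*} [TopologicalSpace H'] (I' : ModelWithCorners ℝ E' H')
  {N : Type*} [TopologicalSpace N] [ChartedSpace H' N]

/-- The vertical distribution `ker F_*`. -/
def vertical (F : M → N) (x : M) : Submodule ℝ (TangentSpace I x) :=
  LinearMap.ker (mfderiv I I' F x : TangentSpace I x →ₗ[ℝ] TangentSpace I' (F x))

/-- The horizontal distribution `(ker F_*)^⊥`. -/
def horizontal (F : M → N) (x : M) : Submodule ℝ (TangentSpace I x) :=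
  (vertical I I' F x)ᗮ

/-- `F` is a Riemannian submersion from `M` onto `N`: a smooth surjective submersion whose
differential preserves the lengths of horizontal vectors. -/
structure IsRiemannianSubmersion [RiemannianBundle (fun y : N => TangentSpace I' y)]
    (F : M → N) : Prop where
  smooth : ContMDiff I I' ∞ F
  surjective : Function.Surjective F
  submersion : ∀ x, Function.Surjective (mfderiv I I' F x)
  isometric : ∀ (x : M), ∀ v ∈ horizontal I I' F x, ‖mfderiv I I' F x v‖ = ‖v‖

/-- `𝒱 X`, the vertical part of the vector field `X`. -/
def vert (F : M → N) (X : Π x : M, TangentSpace I x) (x : M) : TangentSpace I x :=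
  (vertical I I' F x).starProjection (X x)

/-- `ℋ X`, the horizontal part of the vector field `X`. -/
def hor (F : M → N) (X : Π x : M, TangentSpace I x) (x : M) : TangentSpace I x :=
  (horizontal I I' F x).starProjection (X x)

/-- O'Neill's tensor `𝒜_X Y = ℋ ∇_{ℋ X} 𝒱 Y + 𝒱 ∇_{ℋ X} ℋ Y`. -/
def tensorA (F : M → N) (X Y : Π x : M, TangentSpace I x) : Π x : M, TangentSpace I x :=
  hor I I' F (nabla (hor I I' F X) (vert I I' F Y))
    + vert I I' F (nabla (hor I I' F X) (hor I I' F Y))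

/-- `B Z = 𝒱 (J Z)`, the vertical part of `J Z`. -/
def opB (F : M → N) (J : Π x : M, TangentSpace I x →L[ℝ] TangentSpace I x)
    (Z : Π x : M, TangentSpace I x) : Π x : M, TangentSpace I x :=
  vert I I' F (fun x => J x (Z x))

/-- `C Z = ℋ (J Z)`, the horizontal part of `J Z`. -/
def opC (F : M → N) (J : Π x : M, TangentSpace I x →L[ℝ] TangentSpace I x)
    (Z : Π x : M, TangentSpace I x) : Π x : M, TangentSpace I x :=
  hor I I' F (fun x => J x (Z x))

/-- The orthogonal complement `D₂` of `D₁` in `(ker F_*)^⊥`. -/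
def complementIn (F : M → N) (D₁ : Π x : M, Submodule ℝ (TangentSpace I x)) (x : M) :
    Submodule ℝ (TangentSpace I x) :=
  (D₁ x)ᗮ ⊓ horizontal I I' F x

variable {I} in
/-- The projection `P` onto `D₁`: on `(ker F_*)^⊥ = D₁ ⊕ D₂` (an orthogonal sum), the orthogonal
projection to `D₁` is the projection along `D₂`. -/
def projP (D₁ : Π x : M, Submodule ℝ (TangentSpace I x)) (X : Π x : M, TangentSpace I x) (x : M) :
    TangentSpace I x :=
  (D₁ x).starProjection (X x)

/-- The angle between a vector `v` and a subspace `W`: the angle between `v` and its orthogonal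
projection to `W` (which is `π / 2` if that projection vanishes). -/
def angleToSubspace {V : Type*} [NormedAddCommGroup V] [InnerProductSpace ℝ V] (v : V)
    (W : Submodule ℝ V) [W.HasOrthogonalProjection] : ℝ :=
  InnerProductGeometry.angle v (W.starProjection v)

/-- `F` is a v-semi-slant submersion from `(M, g_M, J)` onto `(N, g_N)`, with complex distribution
`D₁` and slant distribution `D₂ = complementIn I I' F D₁`: it is a Riemannian submersion,
`D₁ ⊆ (ker F_*)^⊥` is a smooth distribution with `J D₁ = D₁`, and the angle between `J X` and
`D₂` at `p` is the same for all `p ∈ M` and all nonzero `X ∈ D₂` at `p`. -/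
structure IsVSemiSlantSubmersion [RiemannianBundle (fun y : N => TangentSpace I' y)]
    (J : Π x : M, TangentSpace I x →L[ℝ] TangentSpace I x) (F : M → N)
    (D₁ : Π x : M, Submodule ℝ (TangentSpace I x)) : Prop
    extends IsRiemannianSubmersion I I' F where
  smooth_dist : IsSmoothDistribution D₁
  le_horizontal : ∀ x, D₁ x ≤ horizontal I I' F x
  invariant : ∀ x, (D₁ x).map (J x : TangentSpace I x →ₗ[ℝ] TangentSpace I x) = D₁ x
  slant : ∃ θ : ℝ, ∀ (x : M), ∀ v ∈ complementIn I I' F D₁ x, v ≠ 0 →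
    angleToSubspace (J x v) (complementIn I I' F D₁ x) = θ

end Submersions

end VSemiSlant

end

open VSemiSlant

noncomputable section

namespace VSemiSlant

set_option linter.unusedSectionVars false

section OrthogonalProjection

theorem starProjection_sup_span_singleton {V : Type*} [NormedAddCommGroup V]
    [InnerProductSpace ℝ V] [FiniteDimensional ℝ V] (S : Submodule ℝ V) (w z : V) :
    (Submodule.span ℝ {w} ⊔ S).starProjection z =
      S.starProjection z + (inner ℝ z (w - S.starProjection w) /
        inner ℝ (w - S.starProjection w) (w - S.starProjection w)) •
          (w - S.starProjection w) := by
  set u := w - S.starProjection w with hu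
  have huS : ∀ v ∈ S, inner ℝ v u = 0 := fun v hv =>
    Submodule.inner_right_of_mem_orthogonal hv (S.sub_starProjection_mem_orthogonal w)
  have hle : S ≤ Submodule.span ℝ {w} ⊔ S := le_sup_right
  have hw : w ∈ Submodule.span ℝ {w} ⊔ S :=
    Submodule.mem_sup_left (Submodule.mem_span_singleton_self w)
  have huT : u ∈ Submodule.span ℝ {w} ⊔ S :=
    Submodule.sub_mem _ hw (hle (S.starProjection_apply_mem w))
  have key : inner ℝ (z - (S.starProjection z + (inner ℝ z u / inner ℝ u u) • u)) u = 0 := by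
    rw [inner_sub_left, inner_add_left, huS _ (S.starProjection_apply_mem z), inner_smul_left]
    by_cases h : u = 0
    · simp [h]
    · have : (inner ℝ u u : ℝ) ≠ 0 := inner_self_ne_zero.2 h
      simp only [conj_trivial]
      field_simp
      ring
  have keyS : ∀ v ∈ S,
      inner ℝ (z - (S.starProjection z + (inner ℝ z u / inner ℝ u u) • u)) v = 0 := by
    intro v hv
    have h1 : inner ℝ (z - S.starProjection z) v = 0 :=
      Submodule.inner_left_of_mem_orthogonal hv (S.sub_starProjection_mem_orthogonal z)
    rw [← sub_sub, inner_sub_left, h1, inner_smul_left, real_inner_comm v u, huS v hv]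
    simp
  refine Submodule.eq_starProjection_of_mem_of_inner_eq_zero ?_ ?_
  · exact Submodule.add_mem _ (hle (S.starProjection_apply_mem z)) (Submodule.smul_mem _ _ huT)
  · intro v hv
    obtain ⟨a, ha, b, hb, rfl⟩ := Submodule.mem_sup.1 hv
    obtain ⟨c, rfl⟩ := Submodule.mem_span_singleton.1 ha
    have : c • w + b = c • u + (c • S.starProjection w + b) := by rw [hu]; module
    rw [this, inner_add_right, inner_smul_right, key, keyS]
    · simp
    · exact S.add_mem (S.smul_mem _ (S.starProjection_apply_mem w)) hb

variable {E : Type*} [NormedAddCommGroup E] [NormedSpace ℝ E] [FiniteDimensional ℝ E]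
  {H : Type*} [TopologicalSpace H] {I : ModelWithCorners ℝ E H}
  {M : Type*} [TopologicalSpace M] [ChartedSpace H M] [IsManifold I ∞ M]
  [RiemannianBundle (fun x : M => TangentSpace I x)]
  [IsContMDiffRiemannianBundle I ∞ E (fun x : M => TangentSpace I x)]

/-- The projection of `Z` to the span of differentiable fields that are independent at `p` is
differentiable, even if only the inner products of `Z` with differentiable fields are. -/
theorem mdifferentiableAt_starProjection_span {ι : Type*} {p : M}
    {w : ι → Π x : M, TangentSpace I x} (hw : ∀ i, MDiffAt (T% (w i)) p)
    (hli : LinearIndependent ℝ fun i => w i p) {Z : Π x : M, TangentSpace I x}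
    (hZ : ∀ W : Π x : M, TangentSpace I x, MDiffAt (T% W) p →
      MDiffAt (fun x => (inner ℝ (Z x) (W x) : ℝ)) p) (s : Finset ι) :
    MDiffAt (T% (fun x : M =>
      (Submodule.span ℝ ((fun i => w i x) '' (s : Set ι))).starProjection (Z x))) p := by
  classical
  induction s using Finset.induction_on generalizing Z with
  | empty =>
    simpa using! mdifferentiableAt_zeroSection ℝ (fun x : M => TangentSpace I x) (x := p)
  | insert a s has ih =>
    let u : Π x : M, TangentSpace I x := fun x =>
      w a x - (Submodule.span ℝ ((fun i => w i x) '' (s : Set ι))).starProjection (w a x)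
    have hu : MDiffAt (T% u) p := mdifferentiableAt_sub_section (hw a)
      (ih fun W hW => mdifferentiableAt_inner_field (hw a) hW)
    have hup : (inner ℝ (u p) (u p) : ℝ) ≠ 0 := by
      refine inner_self_ne_zero.2 fun h => ?_
      refine hli.notMem_span_image (s := (s : Set ι)) (x := a) (by simpa using has) ?_
      rw [sub_eq_zero.1 h]
      exact Submodule.starProjection_apply_mem _ _
    have h1 := mdifferentiableAt_add_section (ih hZ)
      (((hZ u hu).mul (MDifferentiableAt.inv (mdifferentiableAt_inner_field hu hu) hup)).smul_section hu)
    refine h1.congr_of_eventuallyEq (Filter.Eventually.of_forall fun x => ?_)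
    simp only [Finset.coe_insert, Set.image_insert_eq, Submodule.span_insert,
      starProjection_sup_span_singleton]
    rfl

/-- A vector field is differentiable at `p` as soon as its inner products with differentiable
fields are. -/
theorem mdifferentiableAt_of_inner {p : M} {Z : Π x : M, TangentSpace I x}
    (hZ : ∀ W : Π x : M, TangentSpace I x, MDiffAt (T% W) p →
      MDiffAt (fun x => (inner ℝ (Z x) (W x) : ℝ)) p) : MDiffAt (T% Z) p := by
  let b := Module.finBasis ℝ E
  let e := trivializationAt E (fun x : M => TangentSpace I x) p
  have hp : p ∈ e.baseSet := mem_baseSet_trivializationAt E (fun x : M => TangentSpace I x) p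
  have hfr := e.isLocalFrameOn_localFrame_baseSet I 1 b
  have h := mdifferentiableAt_starProjection_span (I := I) (p := p) (w := e.localFrame b)
    (fun i => (hfr.contMDiffAt e.open_baseSet hp i).mdifferentiableAt one_ne_zero)
    (hfr.linearIndependent hp) hZ Finset.univ
  refine h.congr_of_eventuallyEq ?_
  filter_upwards [e.open_baseSet.mem_nhds hp] with x hx
  have : Submodule.span ℝ (Set.range fun i => e.localFrame b i x) = ⊤ :=
    top_le_iff.1 (hfr.generating hx)
  simp only [Finset.coe_univ, Set.image_univ, this]
  congr 1
  exact (Submodule.starProjection_eq_self_iff.2 Submodule.mem_top).symm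

end OrthogonalProjection

section LieBracket

variable {E : Type*} [NormedAddCommGroup E] [NormedSpace ℝ E] [FiniteDimensional ℝ E]
  {M : Type*} [TopologicalSpace M] [ChartedSpace E M] [IsManifold 𝓘(ℝ, E) ∞ M]
  {G : Type*} [NormedAddCommGroup G] [NormedSpace ℝ G]

/-- The representation of a vector field in the chart at `p`. -/
def fieldInChart (p : M) (X : Π x : M, TangentSpace 𝓘(ℝ, E) x) : E → E :=
  mpullbackWithin 𝓘(ℝ, E) 𝓘(ℝ, E) (extChartAt 𝓘(ℝ, E) p).symm X (Set.range 𝓘(ℝ, E))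

theorem differentiableAt_fieldInChart {p : M} {X : Π x : M, TangentSpace 𝓘(ℝ, E) x}
    (hX : MDiffAt (T% X) p) :
    DifferentiableAt ℝ (fieldInChart p X) (extChartAt 𝓘(ℝ, E) p p) := by
  have := MDifferentiableWithinAt.differentiableWithinAt_mpullbackWithin_vectorField
    (I := 𝓘(ℝ, E)) (s := Set.univ) (V := X) (x := p) (by simpa using! hX)
  have h1 : ((extChartAt 𝓘(ℝ, E) p).symm ⁻¹' Set.univ ∩ Set.range 𝓘(ℝ, E)) = Set.univ := by simp
  rw [h1] at this
  exact differentiableWithinAt_univ.1 this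

theorem fieldInChart_self (p : M) (X : Π x : M, TangentSpace 𝓘(ℝ, E) x) :
    fieldInChart p X (extChartAt 𝓘(ℝ, E) p p) = X p := by
  have h : ∀ q, q = p →
      (mfderivWithin 𝓘(ℝ, E) 𝓘(ℝ, E) (extChartAt 𝓘(ℝ, E) p).symm (Set.range 𝓘(ℝ, E))
        (extChartAt 𝓘(ℝ, E) p p)).inverse (X q) = X p := by
    rintro q rfl
    rw [mfderivWithin_range_extChartAt_symm]
    exact congrArg (fun L : E →L[ℝ] E => L (X q)) (ContinuousLinearMap.inverse_id)
  exact h _ (extChartAt_to_inv (I := 𝓘(ℝ, E)) p)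

theorem mlieBracket_eq_lieBracket_fieldInChart (p : M)
    (X Y : Π x : M, TangentSpace 𝓘(ℝ, E) x) :
    mlieBracket 𝓘(ℝ, E) X Y p =
      lieBracket ℝ (fieldInChart p X) (fieldInChart p Y) (extChartAt 𝓘(ℝ, E) p p) := by
  have h1 : ((extChartAt 𝓘(ℝ, E) p).symm ⁻¹' Set.univ ∩ Set.range 𝓘(ℝ, E)) = Set.univ := by simp
  rw [← mlieBracketWithin_univ, mlieBracketWithin_apply, h1,
    mfderiv_extChartAt_self]
  refine (congrArg (fun L : E →L[ℝ] E => L _) (ContinuousLinearMap.inverse_id)).trans ?_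
  exact congrFun (lieBracketWithin_univ (𝕜 := ℝ) (V := fieldInChart p X)
    (W := fieldInChart p Y)) _

theorem mvfderiv_apply_eventuallyEq {p : M} {f : M → G}
    (hf : ContMDiffAt 𝓘(ℝ, E) 𝓘(ℝ, G) ∞ f p) (X : Π x : M, TangentSpace 𝓘(ℝ, E) x) :
    (fun x => d% f x (X x)) =ᶠ[nhds p]
      (fun y => fderiv ℝ (f ∘ (extChartAt 𝓘(ℝ, E) p).symm) y (fieldInChart p X y)) ∘
        extChartAt 𝓘(ℝ, E) p := by
  have hev : ∀ᶠ x in nhds p, MDifferentiableAt 𝓘(ℝ, E) 𝓘(ℝ, G) f x := by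
    filter_upwards [contMDiffAt_iff_contMDiffAt_nhds (by simp) |>.1 (hf.of_le (m := 1) (by norm_cast))] with x hx
    exact hx.mdifferentiableAt one_ne_zero
  filter_upwards [hev, extChartAt_source_mem_nhds (I := 𝓘(ℝ, E)) p] with x hfx hx
  set ψ := extChartAt 𝓘(ℝ, E) p with hψ
  have hy : ψ x ∈ ψ.target := ψ.map_source hx
  have hinv := isInvertible_mfderivWithin_extChartAt_symm hy
  have hs : MDifferentiableWithinAt 𝓘(ℝ, E) 𝓘(ℝ, E) ψ.symm (Set.range 𝓘(ℝ, E)) (ψ x) :=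
    mdifferentiableWithinAt_extChartAt_symm hy
  have hxx : ψ.symm (ψ x) = x := ψ.left_inv hx
  have hcomp := mfderiv_comp_mfderivWithin (I := 𝓘(ℝ, E)) (I'' := 𝓘(ℝ, G)) (ψ x) (g := f)
    (by rwa [hxx]) hs (by simpa using uniqueMDiffWithinAt_univ 𝓘(ℝ, E))
  rw [ModelWithCorners.range_eq_univ, mfderivWithin_univ, mfderiv_eq_fderiv] at hcomp
  rw [ModelWithCorners.range_eq_univ] at hinv
  obtain ⟨e, he⟩ := hinv
  have hfield : fieldInChart p X (ψ x) = e.symm (X (ψ.symm (ψ x))) := by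
    rw [fieldInChart, mpullbackWithin_apply, ModelWithCorners.range_eq_univ, ← he,
      ContinuousLinearMap.inverse_equiv]
    rfl
  have hvv : ∀ q, q = x → mvfderiv 𝓘(ℝ, E) f x (X x) = mvfderiv 𝓘(ℝ, E) f q (X q) := by
    rintro q rfl; rfl
  have hey : mfderivWithin 𝓘(ℝ, E) 𝓘(ℝ, E) ψ.symm Set.univ (ψ x)
      (fieldInChart (E := E) p X (ψ x)) =
      X (ψ.symm (ψ x)) := by
    rw [hfield, ← he]
    exact e.toEquiv.apply_symm_apply _
  refine (hvv _ hxx).trans ?_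
  rw [← hey]
  exact (congrArg (fun L : E →L[ℝ] G => L (fieldInChart p X (ψ x))) hcomp).symm

theorem contDiffAt_comp_extChartAt_symm {p : M} {f : M → G}
    (hf : ContMDiffAt 𝓘(ℝ, E) 𝓘(ℝ, G) ∞ f p) :
    ContDiffAt ℝ ∞ (f ∘ (extChartAt 𝓘(ℝ, E) p).symm) (extChartAt 𝓘(ℝ, E) p p) := by
  have := (contMDiffAt_iff.1 hf).2
  simpa [contDiffWithinAt_univ] using! this

theorem hasFDerivAt_fderiv_apply_fieldInChart {p : M} {f : M → G}
    (hf : ContMDiffAt 𝓘(ℝ, E) 𝓘(ℝ, G) ∞ f p) {X : Π x : M, TangentSpace 𝓘(ℝ, E) x}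
    (hX : MDiffAt (T% X) p) :
    HasFDerivAt
      (fun y => fderiv ℝ (f ∘ (extChartAt 𝓘(ℝ, E) p).symm) y (fieldInChart p X y))
      ((fderiv ℝ (f ∘ (extChartAt 𝓘(ℝ, E) p).symm) (extChartAt 𝓘(ℝ, E) p p)).comp
          (fderiv ℝ (fieldInChart p X) (extChartAt 𝓘(ℝ, E) p p)) +
        (fderiv ℝ (fderiv ℝ (f ∘ (extChartAt 𝓘(ℝ, E) p).symm))
          (extChartAt 𝓘(ℝ, E) p p)).flip (fieldInChart p X (extChartAt 𝓘(ℝ, E) p p)))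
      (extChartAt 𝓘(ℝ, E) p p) := by
  have h2 : DifferentiableAt ℝ (fderiv ℝ (f ∘ (extChartAt 𝓘(ℝ, E) p).symm))
      (extChartAt 𝓘(ℝ, E) p p) :=
    ((contDiffAt_comp_extChartAt_symm hf).fderiv_right (m := 1) (by norm_cast)).differentiableAt
      one_ne_zero
  exact h2.hasFDerivAt.clm_apply (differentiableAt_fieldInChart hX).hasFDerivAt

theorem mdifferentiableAt_mvfderiv_apply {p : M} {f : M → G}
    (hf : ContMDiffAt 𝓘(ℝ, E) 𝓘(ℝ, G) ∞ f p) {X : Π x : M, TangentSpace 𝓘(ℝ, E) x}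
    (hX : MDiffAt (T% X) p) :
    MDifferentiableAt 𝓘(ℝ, E) 𝓘(ℝ, G) (fun x => d% f x (X x)) p :=
  ((hasFDerivAt_fderiv_apply_fieldInChart hf hX).differentiableAt.mdifferentiableAt.comp p
    (mdifferentiableAt_extChartAt (mem_chart_source E p))).congr_of_eventuallyEq
      (mvfderiv_apply_eventuallyEq hf X)

theorem mvfderiv_mvfderiv_apply {p : M} {f : M → G}
    (hf : ContMDiffAt 𝓘(ℝ, E) 𝓘(ℝ, G) ∞ f p) {X : Π x : M, TangentSpace 𝓘(ℝ, E) x}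
    (hX : MDiffAt (T% X) p) (v : TangentSpace 𝓘(ℝ, E) p) :
    mvfderiv 𝓘(ℝ, E) (fun x => d% f x (X x)) p v =
      fderiv ℝ (f ∘ (extChartAt 𝓘(ℝ, E) p).symm) (extChartAt 𝓘(ℝ, E) p p)
          (fderiv ℝ (fieldInChart p X) (extChartAt 𝓘(ℝ, E) p p) v) +
        fderiv ℝ (fderiv ℝ (f ∘ (extChartAt 𝓘(ℝ, E) p).symm)) (extChartAt 𝓘(ℝ, E) p p)
          v (X p) := by
  have hd := hasFDerivAt_fderiv_apply_fieldInChart hf hX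
  have hψ := mdifferentiableAt_extChartAt (I := 𝓘(ℝ, E)) (mem_chart_source E p)
  have h1 : mfderiv 𝓘(ℝ, E) 𝓘(ℝ, G) (fun x => d% f x (X x)) p = _ :=
    (mvfderiv_apply_eventuallyEq hf X).mfderiv_eq.trans
      (mfderiv_comp p hd.differentiableAt.mdifferentiableAt hψ)
  rw [mfderiv_eq_fderiv, hd.fderiv, mfderiv_extChartAt_self, fieldInChart_self] at h1
  exact congrArg (fun L : E →L[ℝ] G => L v) h1

/-- The bracket of vector fields is the commutator of derivations, on vector-valued functions. -/
theorem mvfderiv_mlieBracket {p : M} {f : M → G}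
    (hf : ContMDiffAt 𝓘(ℝ, E) 𝓘(ℝ, G) ∞ f p) {X Y : Π x : M, TangentSpace 𝓘(ℝ, E) x}
    (hX : MDiffAt (T% X) p) (hY : MDiffAt (T% Y) p) :
    mvfderiv 𝓘(ℝ, E) f p (mlieBracket 𝓘(ℝ, E) X Y p) =
      mvfderiv 𝓘(ℝ, E) (fun x => d% f x (Y x)) p (X p) -
        mvfderiv 𝓘(ℝ, E) (fun x => d% f x (X x)) p (Y p) := by
  have hfp : MDifferentiableAt 𝓘(ℝ, E) 𝓘(ℝ, G) f p := hf.mdifferentiableAt (by simp)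
  have hsymm : IsSymmSndFDerivAt ℝ (f ∘ (extChartAt 𝓘(ℝ, E) p).symm)
      (extChartAt 𝓘(ℝ, E) p p) :=
    (contDiffAt_comp_extChartAt_symm hf).isSymmSndFDerivAt
      (by simpa using! (by norm_cast : (2 : WithTop ℕ∞) ≤ ∞))
  have hf1 : mvfderiv 𝓘(ℝ, E) f p =
      fderiv ℝ (f ∘ (extChartAt 𝓘(ℝ, E) p).symm) (extChartAt 𝓘(ℝ, E) p p) := by
    refine hfp.mvfderiv.trans ?_
    rw [ModelWithCorners.range_eq_univ, fderivWithin_univ]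
    rfl
  rw [mvfderiv_mvfderiv_apply hf hY, mvfderiv_mvfderiv_apply hf hX, hf1,
    mlieBracket_eq_lieBracket_fieldInChart, lieBracket, fieldInChart_self, fieldInChart_self,
    hsymm (X p) (Y p)]
  rw [add_sub_add_right_eq_sub]
  exact map_sub _ _ _

end LieBracket

section HorizontalProjection

variable {E : Type*} [NormedAddCommGroup E] [NormedSpace ℝ E] [FiniteDimensional ℝ E]
  {M : Type*} [TopologicalSpace M] [ChartedSpace E M] [IsManifold 𝓘(ℝ, E) ∞ M]
  [RiemannianBundle (fun x : M => TangentSpace 𝓘(ℝ, E) x)]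
  [IsContMDiffRiemannianBundle 𝓘(ℝ, E) ∞ E (fun x : M => TangentSpace 𝓘(ℝ, E) x)]
  {E' : Type*} [NormedAddCommGroup E'] [NormedSpace ℝ E'] [FiniteDimensional ℝ E']
  {N : Type*} [TopologicalSpace N] [ChartedSpace E' N] [IsManifold 𝓘(ℝ, E') ∞ N]

/-- The Riemannian gradient of a function. -/
def gradField (f : M → ℝ) (x : M) : TangentSpace 𝓘(ℝ, E) x :=
  (InnerProductSpace.toDual ℝ (TangentSpace 𝓘(ℝ, E) x)).symm (mvfderiv 𝓘(ℝ, E) f x)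

theorem inner_gradField (f : M → ℝ) (x : M) (v : TangentSpace 𝓘(ℝ, E) x) :
    inner ℝ (gradField f x) v = mvfderiv 𝓘(ℝ, E) f x v :=
  InnerProductSpace.toDual_symm_apply

theorem mdifferentiableAt_gradField {f : M → ℝ} {p : M}
    (hf : ContMDiffAt 𝓘(ℝ, E) 𝓘(ℝ, ℝ) ∞ f p) :
    MDiffAt (T% (gradField (E := E) f)) p :=
  mdifferentiableAt_of_inner fun W hW => by
    simpa only [inner_gradField] using mdifferentiableAt_mvfderiv_apply hf hW

/-- The map `F` read in the preferred chart of `N` at `F p`. -/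
def targetChartMap (E' : Type*) [NormedAddCommGroup E'] [NormedSpace ℝ E'] [ChartedSpace E' N]
    (F : M → N) (p : M) : M → E' :=
  extChartAt 𝓘(ℝ, E') (F p) ∘ F

theorem contMDiffAt_targetChartMap {F : M → N} (hF : ContMDiff 𝓘(ℝ, E) 𝓘(ℝ, E') ∞ F) (p : M) :
    ContMDiffAt 𝓘(ℝ, E) 𝓘(ℝ, E') ∞ (targetChartMap E' F p) p :=
  (contMDiffAt_extChartAt (I := 𝓘(ℝ, E')) (x := F p)).comp p hF.contMDiffAt

theorem eventually_mem_chartAt_source {F : M → N} (hF : ContMDiff 𝓘(ℝ, E) 𝓘(ℝ, E') ∞ F) (p : M) :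
    ∀ᶠ x in nhds p, F x ∈ (chartAt E' (F p)).source :=
  hF.continuous.continuousAt.eventually (chart_source_mem_nhds E' (F p))

theorem mvfderiv_targetChartMap {F : M → N} (hF : ContMDiff 𝓘(ℝ, E) 𝓘(ℝ, E') ∞ F) {p x : M}
    (hx : F x ∈ (chartAt E' (F p)).source) (v : TangentSpace 𝓘(ℝ, E) x) :
    mvfderiv 𝓘(ℝ, E) (targetChartMap E' F p) x v =
      mfderiv 𝓘(ℝ, E') 𝓘(ℝ, E') (extChartAt 𝓘(ℝ, E') (F p)) (F x)
        (mfderiv 𝓘(ℝ, E) 𝓘(ℝ, E') F x v) :=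
  mfderiv_comp_apply x (mdifferentiableAt_extChartAt hx)
    (hF.contMDiffAt.mdifferentiableAt (by simp)) v

theorem mvfderiv_targetChartMap_self {F : M → N} (hF : ContMDiff 𝓘(ℝ, E) 𝓘(ℝ, E') ∞ F) (p : M)
    (v : TangentSpace 𝓘(ℝ, E) p) :
    mvfderiv 𝓘(ℝ, E) (targetChartMap E' F p) p v = mfderiv 𝓘(ℝ, E) 𝓘(ℝ, E') F p v := by
  rw [mvfderiv_targetChartMap hF (mem_chart_source E' (F p)), mfderiv_extChartAt_self]
  rfl

theorem mvfderiv_targetChartMap_eq_zero_iff {F : M → N}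
    (hF : ContMDiff 𝓘(ℝ, E) 𝓘(ℝ, E') ∞ F) {p x : M} (hx : F x ∈ (chartAt E' (F p)).source)
    (v : TangentSpace 𝓘(ℝ, E) x) :
    mvfderiv 𝓘(ℝ, E) (targetChartMap E' F p) x v = 0 ↔ v ∈ vertical 𝓘(ℝ, E) 𝓘(ℝ, E') F x := by
  rw [mvfderiv_targetChartMap hF hx]
  obtain ⟨e, he⟩ := isInvertible_mfderiv_extChartAt (I := 𝓘(ℝ, E')) (x := F p) (y := F x)
    (by simpa using hx)
  rw [← he]
  exact e.map_eq_zero_iff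

/-- A coordinate of `F` in the preferred chart of `N` at `F p`. -/
def targetCoord (E' : Type*) [NormedAddCommGroup E'] [NormedSpace ℝ E'] [FiniteDimensional ℝ E']
    [ChartedSpace E' N] (F : M → N) (p : M) (i : Fin (Module.finrank ℝ E')) : M → ℝ :=
  fun x => ((Module.finBasis ℝ E').coord i).toContinuousLinearMap (targetChartMap E' F p x)

theorem contMDiffAt_targetCoord {F : M → N} (hF : ContMDiff 𝓘(ℝ, E) 𝓘(ℝ, E') ∞ F) (p : M)
    (i : Fin (Module.finrank ℝ E')) :
    ContMDiffAt 𝓘(ℝ, E) 𝓘(ℝ, ℝ) ∞ (targetCoord E' F p i) p :=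
  (ContinuousLinearMap.contMDiff _).contMDiffAt.comp p (contMDiffAt_targetChartMap hF p)

theorem mvfderiv_targetCoord {F : M → N} (hF : ContMDiff 𝓘(ℝ, E) 𝓘(ℝ, E') ∞ F) {p x : M}
    (hx : F x ∈ (chartAt E' (F p)).source) (i : Fin (Module.finrank ℝ E'))
    (v : TangentSpace 𝓘(ℝ, E) x) :
    mvfderiv 𝓘(ℝ, E) (targetCoord E' F p i) x v =
      (Module.finBasis ℝ E').coord i (mvfderiv 𝓘(ℝ, E) (targetChartMap E' F p) x v) := by
  have hd : MDifferentiableAt 𝓘(ℝ, E) 𝓘(ℝ, E') (targetChartMap E' F p) x :=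
    (mdifferentiableAt_extChartAt (I := 𝓘(ℝ, E')) hx).comp x
      (hF.contMDiffAt.mdifferentiableAt (by simp))
  have := mfderiv_comp_apply (I' := 𝓘(ℝ, E')) (I'' := 𝓘(ℝ, ℝ)) x
    (((Module.finBasis ℝ E').coord i).toContinuousLinearMap.mdifferentiableAt) hd v
  rw [ContinuousLinearMap.mfderiv_eq] at this
  exact this

theorem span_gradField_eq_horizontal {F : M → N} (hF : ContMDiff 𝓘(ℝ, E) 𝓘(ℝ, E') ∞ F) {p x : M}
    (hx : F x ∈ (chartAt E' (F p)).source) :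
    Submodule.span ℝ (Set.range fun i => gradField (E := E) (targetCoord E' F p i) x) =
      horizontal 𝓘(ℝ, E) 𝓘(ℝ, E') F x := by
  rw [← Submodule.orthogonal_orthogonal (Submodule.span ℝ _), horizontal]
  congr 1
  ext v
  rw [← mvfderiv_targetChartMap_eq_zero_iff hF hx, Submodule.mem_orthogonal,
    ← (Module.finBasis ℝ E').forall_coord_eq_zero_iff]
  simp only [← mvfderiv_targetCoord hF hx, ← inner_gradField]
  refine ⟨fun h i => h _ (Submodule.subset_span ⟨i, rfl⟩), fun h u hu => ?_⟩
  induction hu using Submodule.span_induction with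
  | mem u hu => obtain ⟨i, rfl⟩ := hu; exact h i
  | zero => simp
  | add a b _ _ ha hb => rw [inner_add_left, ha, hb, add_zero]
  | smul c a _ ha => rw [inner_smul_left, ha, mul_zero]

theorem linearIndependent_gradField {F : M → N} (hF : ContMDiff 𝓘(ℝ, E) 𝓘(ℝ, E') ∞ F) {p : M}
    (hsub : Function.Surjective (mfderiv 𝓘(ℝ, E) 𝓘(ℝ, E') F p)) :
    LinearIndependent ℝ fun i => gradField (E := E) (targetCoord E' F p i) p := by
  rw [Fintype.linearIndependent_iff]
  intro c hc j
  obtain ⟨v, hv⟩ := hsub (Module.finBasis ℝ E' j)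
  have h : ∀ i, inner ℝ (gradField (E := E) (targetCoord E' F p i) p) v =
      if j = i then (1 : ℝ) else 0 := fun i => by
    rw [inner_gradField, mvfderiv_targetCoord hF (mem_chart_source E' (F p)),
      mvfderiv_targetChartMap_self hF, hv]
    simp [Finsupp.single_apply]
  have := congrArg (fun u => inner ℝ u v) hc
  simpa [sum_inner, inner_smul_left, h] using this

theorem mdifferentiableAt_hor {F : M → N} (hF : ContMDiff 𝓘(ℝ, E) 𝓘(ℝ, E') ∞ F) {p : M}
    (hsub : Function.Surjective (mfderiv 𝓘(ℝ, E) 𝓘(ℝ, E') F p))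
    {Z : Π x : M, TangentSpace 𝓘(ℝ, E) x} (hZ : MDiffAt (T% Z) p) :
    MDiffAt (T% (hor 𝓘(ℝ, E) 𝓘(ℝ, E') F Z)) p := by
  have h := mdifferentiableAt_starProjection_span (I := 𝓘(ℝ, E))
    (w := fun i => gradField (E := E) (targetCoord E' F p i))
    (fun i => mdifferentiableAt_gradField (contMDiffAt_targetCoord hF p i))
    (linearIndependent_gradField hF hsub) (fun W hW => mdifferentiableAt_inner_field hZ hW)
    Finset.univ
  refine h.congr_of_eventuallyEq ?_
  filter_upwards [eventually_mem_chartAt_source hF p] with x hx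
  simp only [Finset.coe_univ, Set.image_univ, span_gradField_eq_horizontal hF hx, hor]

theorem hor_add_vert (F : M → N) (Z : Π x : M, TangentSpace 𝓘(ℝ, E) x) :
    hor 𝓘(ℝ, E) 𝓘(ℝ, E') F Z + vert 𝓘(ℝ, E) 𝓘(ℝ, E') F Z = Z := by
  ext x
  simp only [Pi.add_apply, hor, vert, horizontal, Submodule.starProjection_orthogonal_val]
  exact sub_add_cancel _ _

theorem mdifferentiableAt_vert {F : M → N} (hF : ContMDiff 𝓘(ℝ, E) 𝓘(ℝ, E') ∞ F) {p : M}
    (hsub : Function.Surjective (mfderiv 𝓘(ℝ, E) 𝓘(ℝ, E') F p))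
    {Z : Π x : M, TangentSpace 𝓘(ℝ, E) x} (hZ : MDiffAt (T% Z) p) :
    MDiffAt (T% (vert 𝓘(ℝ, E) 𝓘(ℝ, E') F Z)) p := by
  rw [eq_sub_of_add_eq' (hor_add_vert F Z)]
  exact mdifferentiableAt_sub_section hZ (mdifferentiableAt_hor hF hsub hZ)

end HorizontalProjection

section RiemannianSubmersion

variable {E : Type*} [NormedAddCommGroup E] [NormedSpace ℝ E] [FiniteDimensional ℝ E]
  {M : Type*} [TopologicalSpace M] [ChartedSpace E M] [IsManifold 𝓘(ℝ, E) ∞ M]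
  [RiemannianBundle (fun x : M => TangentSpace 𝓘(ℝ, E) x)]
  [IsContMDiffRiemannianBundle 𝓘(ℝ, E) ∞ E (fun x : M => TangentSpace 𝓘(ℝ, E) x)]
  {E' : Type*} [NormedAddCommGroup E'] [NormedSpace ℝ E'] [FiniteDimensional ℝ E']
  {N : Type*} [TopologicalSpace N] [ChartedSpace E' N] [IsManifold 𝓘(ℝ, E') ∞ N]

theorem mdifferentiableAt_and_mvfderiv_sum {ι : Type*} (s : Finset ι) {f : ι → M → ℝ} {p : M}
    (hf : ∀ i, MDifferentiableAt 𝓘(ℝ, E) 𝓘(ℝ, ℝ) (f i) p) :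
    MDifferentiableAt 𝓘(ℝ, E) 𝓘(ℝ, ℝ) (fun x => ∑ i ∈ s, f i x) p ∧
    ∀ v : TangentSpace 𝓘(ℝ, E) p, mvfderiv 𝓘(ℝ, E) (fun x => ∑ i ∈ s, f i x) p v =
      ∑ i ∈ s, mvfderiv 𝓘(ℝ, E) (f i) p v := by
  classical
  induction s using Finset.induction_on with
  | empty => exact ⟨by simpa using mdifferentiableAt_const, fun v => by simp [mvfderiv_const]⟩
  | insert a s has ih =>
    simp only [Finset.sum_insert has]
    refine ⟨(hf a).add ih.1, fun v => ?_⟩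
    rw [mvfderiv_fun_add (hf a) ih.1, add_apply, ih.2]

/-- The coordinate frame of `N` around `q`. -/
def coordFrame (E' : Type*) [NormedAddCommGroup E'] [NormedSpace ℝ E'] [FiniteDimensional ℝ E']
    [ChartedSpace E' N] [IsManifold 𝓘(ℝ, E') ∞ N] (q : N) (i : Fin (Module.finrank ℝ E')) (y : N) :
    TangentSpace 𝓘(ℝ, E') y :=
  (trivializationAt E' (fun y : N => TangentSpace 𝓘(ℝ, E') y) q).localFrame
    (Module.finBasis ℝ E') i y

theorem mdifferentiableAt_coordFrame (q : N) (i : Fin (Module.finrank ℝ E')) :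
    MDiffAt (T% (coordFrame E' q i)) q :=
  (contMDiffAt_localFrame_of_mem 1 _ _ i
    (mem_baseSet_trivializationAt E' (fun y : N => TangentSpace 𝓘(ℝ, E') y) q)).mdifferentiableAt
      one_ne_zero

theorem mfderiv_eq_sum_coordFrame {F : M → N} (hF : ContMDiff 𝓘(ℝ, E) 𝓘(ℝ, E') ∞ F) {p x : M}
    (hx : F x ∈ (chartAt E' (F p)).source) (v : TangentSpace 𝓘(ℝ, E) x) :
    mfderiv 𝓘(ℝ, E) 𝓘(ℝ, E') F x v =
      ∑ i, mvfderiv 𝓘(ℝ, E) (targetCoord E' F p i) x v • coordFrame E' (F p) i (F x) := by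
  have hb : F x ∈ (trivializationAt E' (fun y : N => TangentSpace 𝓘(ℝ, E') y) (F p)).baseSet := by
    simpa using hx
  refine ((Bundle.Trivialization.basisAt _ (Module.finBasis ℝ E') hb).sum_repr _).symm.trans ?_
  refine Finset.sum_congr rfl fun i _ => ?_
  rw [coordFrame, Bundle.Trivialization.localFrame_apply_of_mem_baseSet _ _ hb,
    mvfderiv_targetCoord hF hx, mvfderiv_targetChartMap hF hx]
  have h : (mfderiv 𝓘(ℝ, E') 𝓘(ℝ, E') (extChartAt 𝓘(ℝ, E') (F p)) (F x)
      (mfderiv 𝓘(ℝ, E) 𝓘(ℝ, E') F x v) : E') =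
      Bundle.Trivialization.linearEquivAt ℝ
        (trivializationAt E' (fun y : N => TangentSpace 𝓘(ℝ, E') y) (F p)) (F x) hb
        (mfderiv 𝓘(ℝ, E) 𝓘(ℝ, E') F x v) := by
    have h1 := congrArg (fun L : TangentSpace 𝓘(ℝ, E') (F x) →L[ℝ] E' =>
      L (mfderiv 𝓘(ℝ, E) 𝓘(ℝ, E') F x v))
      (TangentBundle.continuousLinearMapAt_trivializationAt (𝕜 := ℝ) (I := 𝓘(ℝ, E')) hx)
    exact h1.symm.trans (congrFun (Bundle.Trivialization.coe_linearMapAt_of_mem (R := ℝ) _ hb) _)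
  exact congrArg (fun z : E' => (Module.finBasis ℝ E').repr z i • Bundle.Trivialization.basisAt
    (trivializationAt E' (fun y : N => TangentSpace 𝓘(ℝ, E') y) (F p))
    (Module.finBasis ℝ E') hb i) h.symm

variable [RiemannianBundle (fun y : N => TangentSpace 𝓘(ℝ, E') y)]
  [IsContMDiffRiemannianBundle 𝓘(ℝ, E') ∞ E' (fun y : N => TangentSpace 𝓘(ℝ, E') y)]

theorem IsRiemannianSubmersion.inner_mfderiv {F : M → N}
    (hF : IsRiemannianSubmersion 𝓘(ℝ, E) 𝓘(ℝ, E') F) {x : M} (u : TangentSpace 𝓘(ℝ, E) x)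
    {w : TangentSpace 𝓘(ℝ, E) x} (hw : w ∈ horizontal 𝓘(ℝ, E) 𝓘(ℝ, E') F x) :
    inner ℝ (mfderiv 𝓘(ℝ, E) 𝓘(ℝ, E') F x u) (mfderiv 𝓘(ℝ, E) 𝓘(ℝ, E') F x w) = inner ℝ u w := by
  set a := (horizontal 𝓘(ℝ, E) 𝓘(ℝ, E') F x).starProjection u with ha_def
  have ha : a ∈ horizontal 𝓘(ℝ, E) 𝓘(ℝ, E') F x := Submodule.starProjection_apply_mem _ _
  have hua : u - a ∈ (horizontal 𝓘(ℝ, E) 𝓘(ℝ, E') F x)ᗮ :=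
    Submodule.sub_starProjection_mem_orthogonal u
  have hker : mfderiv 𝓘(ℝ, E) 𝓘(ℝ, E') F x (u - a) = 0 := by
    rw [horizontal, Submodule.orthogonal_orthogonal] at hua
    exact hua
  have h1 : mfderiv 𝓘(ℝ, E) 𝓘(ℝ, E') F x u = mfderiv 𝓘(ℝ, E) 𝓘(ℝ, E') F x a := by
    rw [map_sub] at hker
    exact sub_eq_zero.1 hker
  have h2 : inner ℝ u w = inner ℝ a w := by
    have := Submodule.inner_left_of_mem_orthogonal hw hua
    rw [inner_sub_left] at this
    exact sub_eq_zero.1 this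
  have h3 := hF.isometric x (a + w) (Submodule.add_mem _ ha hw)
  rw [map_add] at h3
  rw [h1, h2, real_inner_eq_norm_add_mul_self_sub_norm_mul_self_sub_norm_mul_self_div_two,
    real_inner_eq_norm_add_mul_self_sub_norm_mul_self_sub_norm_mul_self_div_two, h3,
    hF.isometric x a ha, hF.isometric x w hw]

/-- The metric on the horizontal bundle of a Riemannian submersion is invariant along the fibres. -/
theorem IsRiemannianSubmersion.mvfderiv_inner_self {F : M → N}
    (hF : IsRiemannianSubmersion 𝓘(ℝ, E) 𝓘(ℝ, E') F) {p : M}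
    {X U : Π x : M, TangentSpace 𝓘(ℝ, E) x} (hX : MDiffAt (T% X) p) (hU : MDiffAt (T% U) p)
    (hXh : ∀ x, X x ∈ horizontal 𝓘(ℝ, E) 𝓘(ℝ, E') F x)
    (hUv : ∀ x, U x ∈ vertical 𝓘(ℝ, E) 𝓘(ℝ, E') F x) :
    mvfderiv 𝓘(ℝ, E) (fun x => (inner ℝ (X x) (X x) : ℝ)) p (U p) =
      2 * inner ℝ (mlieBracket 𝓘(ℝ, E) U X p) (X p) := by
  let c : Fin (Module.finrank ℝ E') → M → ℝ := fun i x =>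
    mvfderiv 𝓘(ℝ, E) (targetCoord E' F p i) x (X x)
  let a : Fin (Module.finrank ℝ E') → ℝ := fun i =>
    mvfderiv 𝓘(ℝ, E) (targetCoord E' F p i) p (mlieBracket 𝓘(ℝ, E) U X p)
  let γ : Fin (Module.finrank ℝ E') → Fin (Module.finrank ℝ E') → N → ℝ := fun i j y =>
    inner ℝ (coordFrame E' (F p) i y) (coordFrame E' (F p) j y)
  have hFp : MDifferentiableAt 𝓘(ℝ, E) 𝓘(ℝ, E') F p :=
    hF.smooth.contMDiffAt.mdifferentiableAt (by simp)
  have hγ : ∀ i j, MDifferentiableAt 𝓘(ℝ, E') 𝓘(ℝ, ℝ) (γ i j) (F p) := fun i j =>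
    mdifferentiableAt_inner_field (mdifferentiableAt_coordFrame (F p) i)
      (mdifferentiableAt_coordFrame (F p) j)
  have hγF : ∀ i j, MDifferentiableAt 𝓘(ℝ, E) 𝓘(ℝ, ℝ) (fun x => γ i j (F x)) p := fun i j =>
    (hγ i j).comp p hFp
  have hdγ : ∀ i j, mvfderiv 𝓘(ℝ, E) (fun x => γ i j (F x)) p (U p) = 0 := fun i j => by
    have h1 := mvfderiv_comp_apply p (hγ i j) hFp (U p)
    have h2 : mfderiv 𝓘(ℝ, E) 𝓘(ℝ, E') F p (U p) = 0 := hUv p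
    rw [h2, map_zero] at h1
    exact h1
  have hc : ∀ i, MDifferentiableAt 𝓘(ℝ, E) 𝓘(ℝ, ℝ) (c i) p := fun i =>
    mdifferentiableAt_mvfderiv_apply (contMDiffAt_targetCoord hF.smooth p i) hX
  have hdc : ∀ i, mvfderiv 𝓘(ℝ, E) (c i) p (U p) = a i := fun i => by
    have h1 := mvfderiv_mlieBracket (contMDiffAt_targetCoord hF.smooth p i) hU hX
    have h2 : (fun x => mvfderiv 𝓘(ℝ, E) (targetCoord E' F p i) x (U x)) =ᶠ[nhds p]
        fun _ => (0 : ℝ) := by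
      filter_upwards [eventually_mem_chartAt_source hF.smooth p] with x hx
      rw [mvfderiv_targetCoord hF.smooth hx,
        (mvfderiv_targetChartMap_eq_zero_iff hF.smooth hx _).2 (hUv x), map_zero]
    have h3 : mvfderiv 𝓘(ℝ, E) (fun x => mvfderiv 𝓘(ℝ, E) (targetCoord E' F p i) x (U x)) p (X p)
        = 0 := by
      have h4 : mfderiv 𝓘(ℝ, E) 𝓘(ℝ, ℝ)
          (fun x => mvfderiv 𝓘(ℝ, E) (targetCoord E' F p i) x (U x)) p = 0 :=
        h2.mfderiv_eq.trans mfderiv_const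
      rw [mvfderiv, h4]
      simp
    rw [h3, sub_zero] at h1
    exact h1.symm
  have hev : (fun x => (inner ℝ (X x) (X x) : ℝ)) =ᶠ[nhds p]
      fun x => ∑ i, ∑ j, c i x * c j x * γ i j (F x) := by
    filter_upwards [eventually_mem_chartAt_source hF.smooth p] with x hx
    rw [← hF.inner_mfderiv (X x) (hXh x), mfderiv_eq_sum_coordFrame hF.smooth hx, sum_inner]
    simp only [inner_sum, inner_smul_left, inner_smul_right, conj_trivial]
    refine Finset.sum_congr rfl fun i _ => Finset.sum_congr rfl fun j _ => ?_
    simp only [c, γ]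
    ring
  have hterm : ∀ i j, MDifferentiableAt 𝓘(ℝ, E) 𝓘(ℝ, ℝ)
      (fun x => c i x * c j x * γ i j (F x)) p := fun i j => ((hc i).mul (hc j)).mul (hγF i j)
  have hdterm : ∀ i j, mvfderiv 𝓘(ℝ, E) (fun x => c i x * c j x * γ i j (F x)) p (U p) =
      c i p * a j * γ i j (F p) + a i * c j p * γ i j (F p) := fun i j => by
    have hcc : MDifferentiableAt 𝓘(ℝ, E) 𝓘(ℝ, ℝ) (fun x => c i x * c j x) p := (hc i).mul (hc j)
    rw [mvfderiv_fun_mul hcc (hγF i j), mvfderiv_fun_mul (hc i) (hc j)]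
    simp only [add_apply, smul_apply, hdγ, hdc, smul_eq_mul]
    ring
  have hlhs : mvfderiv 𝓘(ℝ, E) (fun x => (inner ℝ (X x) (X x) : ℝ)) p (U p) =
      mvfderiv 𝓘(ℝ, E) (fun x => ∑ i, ∑ j, c i x * c j x * γ i j (F x)) p (U p) :=
    congrArg (fun L : E →L[ℝ] ℝ => L (U p)) hev.mfderiv_eq
  rw [hlhs, (mdifferentiableAt_and_mvfderiv_sum Finset.univ fun i =>
    (mdifferentiableAt_and_mvfderiv_sum Finset.univ (hterm i)).1).2]
  simp only [(mdifferentiableAt_and_mvfderiv_sum Finset.univ (hterm _)).2, hdterm,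
    Finset.sum_add_distrib]
  have hrhs : inner ℝ (mlieBracket 𝓘(ℝ, E) U X p) (X p) =
      ∑ i, ∑ j, a i * c j p * γ i j (F p) := by
    rw [← hF.inner_mfderiv _ (hXh p),
      mfderiv_eq_sum_coordFrame hF.smooth (mem_chart_source E' (F p)),
      mfderiv_eq_sum_coordFrame hF.smooth (mem_chart_source E' (F p)) (X p), sum_inner]
    simp only [inner_sum, inner_smul_left, inner_smul_right, conj_trivial]
    refine Finset.sum_congr rfl fun i _ => Finset.sum_congr rfl fun j _ => ?_
    simp only [c, γ, a]
    ring
  have hswap : ∑ i, ∑ j, c i p * a j * γ i j (F p) = ∑ i, ∑ j, a i * c j p * γ i j (F p) := by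
    rw [Finset.sum_comm]
    refine Finset.sum_congr rfl fun i _ => Finset.sum_congr rfl fun j _ => ?_
    rw [show γ j i (F p) = γ i j (F p) from real_inner_comm _ _]
    ring
  rw [hrhs, hswap]
  ring

theorem IsRiemannianSubmersion.inner_nabla_self {F : M → N}
    (hF : IsRiemannianSubmersion 𝓘(ℝ, E) 𝓘(ℝ, E') F) {p : M}
    {X U : Π x : M, TangentSpace 𝓘(ℝ, E) x} (hX : MDiffAt (T% X) p) (hU : MDiffAt (T% U) p)
    (hXh : ∀ x, X x ∈ horizontal 𝓘(ℝ, E) 𝓘(ℝ, E') F x)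
    (hUv : ∀ x, U x ∈ vertical 𝓘(ℝ, E) 𝓘(ℝ, E') F x) :
    inner ℝ (nabla X X p) (U p) = 0 := by
  have hXU : (fun x => (inner ℝ (X x) (U x) : ℝ)) = fun _ => 0 := by
    ext x
    exact Submodule.inner_left_of_mem_orthogonal (hUv x) (hXh x)
  have h1 := leviCivita_metric hX hX hU
  rw [hXU, mvfderiv_const] at h1
  have h2 := leviCivita_metric hU hX hX
  rw [hF.mvfderiv_inner_self hX hU hXh hUv, ← leviCivita_torsionFree hU hX, inner_sub_left,
    real_inner_comm (nabla U X p) (X p)] at h2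
  rw [real_inner_comm (nabla X U p) (X p)] at h1
  simp only [zero_apply] at h1
  linarith

/-- For horizontal fields, twice the vertical part of `∇_X Y` is the vertical part of `[X, Y]`. -/
theorem IsRiemannianSubmersion.two_mul_inner_nabla {F : M → N}
    (hF : IsRiemannianSubmersion 𝓘(ℝ, E) 𝓘(ℝ, E') F) {p : M}
    {X Y : Π x : M, TangentSpace 𝓘(ℝ, E) x} (hX : MDiffAt (T% X) p) (hY : MDiffAt (T% Y) p)
    (hXh : ∀ x, X x ∈ horizontal 𝓘(ℝ, E) 𝓘(ℝ, E') F x)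
    (hYh : ∀ x, Y x ∈ horizontal 𝓘(ℝ, E) 𝓘(ℝ, E') F x) {u : TangentSpace 𝓘(ℝ, E) p}
    (hu : u ∈ vertical 𝓘(ℝ, E) 𝓘(ℝ, E') F p) :
    2 * inner ℝ (nabla X Y p) u = inner ℝ (mlieBracket 𝓘(ℝ, E) X Y p) u := by
  let U := vert 𝓘(ℝ, E) 𝓘(ℝ, E') F (FiberBundle.extend E u)
  have hU : MDiffAt (T% U) p :=
    mdifferentiableAt_vert hF.smooth (hF.submersion p) (FiberBundle.mdifferentiableAt_extend ..)
  have hUv : ∀ x, U x ∈ vertical 𝓘(ℝ, E) 𝓘(ℝ, E') F x := fun x =>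
    Submodule.starProjection_apply_mem _ _
  have hUp : U p = u := by
    simp only [U, vert, FiberBundle.extend_apply_self]
    exact Submodule.starProjection_eq_self_iff.2 hu
  have h1 := hF.inner_nabla_self hX hU hXh hUv
  have h2 := hF.inner_nabla_self hY hU hYh hUv
  have h3 := hF.inner_nabla_self (mdifferentiableAt_add_section hX hY) hU
    (fun x => Submodule.add_mem _ (hXh x) (hYh x)) hUv
  have h4 : nabla (X + Y) (X + Y) p = nabla X X p + nabla Y X p + (nabla X Y p + nabla Y Y p) := by
    simp only [nabla, (leviCivita 𝓘(ℝ, E) M).isCovariantDerivativeOnUniv.add hX hY,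
      Pi.add_apply, map_add, add_apply]
    abel
  rw [h4, inner_add_left, inner_add_left, inner_add_left, h1, h2, hUp] at h3
  rw [← leviCivita_torsionFree hX hY, inner_sub_left]
  linarith

end RiemannianSubmersion

section SlantDistribution

variable {E : Type*} [NormedAddCommGroup E] [NormedSpace ℝ E] [FiniteDimensional ℝ E]
  {M : Type*} [TopologicalSpace M] [ChartedSpace E M] [IsManifold 𝓘(ℝ, E) ∞ M]
  [RiemannianBundle (fun x : M => TangentSpace 𝓘(ℝ, E) x)]
  [IsContMDiffRiemannianBundle 𝓘(ℝ, E) ∞ E (fun x : M => TangentSpace 𝓘(ℝ, E) x)]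
  {E' : Type*} [NormedAddCommGroup E'] [NormedSpace ℝ E'] [FiniteDimensional ℝ E']
  {N : Type*} [TopologicalSpace N] [ChartedSpace E' N] [IsManifold 𝓘(ℝ, E') ∞ N]

theorem nabla_zero_right (X : Π x : M, TangentSpace 𝓘(ℝ, E) x) : nabla X 0 = 0 := by
  ext x
  have h0 : MDiffAt (T% (0 : Π x : M, TangentSpace 𝓘(ℝ, E) x)) x :=
    mdifferentiableAt_zeroSection ℝ (fun x : M => TangentSpace 𝓘(ℝ, E) x)
  have := (leviCivita 𝓘(ℝ, E) M).isCovariantDerivativeOnUniv.add h0 h0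
  rw [add_zero] at this
  have h := left_eq_add.1 this
  rw [nabla, h]
  rfl

theorem hor_eq_self {F : M → N} {X : Π x : M, TangentSpace 𝓘(ℝ, E) x}
    (hX : ∀ x, X x ∈ horizontal 𝓘(ℝ, E) 𝓘(ℝ, E') F x) : hor 𝓘(ℝ, E) 𝓘(ℝ, E') F X = X :=
  funext fun x => Submodule.starProjection_eq_self_iff.2 (hX x)

theorem vert_eq_zero {F : M → N} {X : Π x : M, TangentSpace 𝓘(ℝ, E) x}
    (hX : ∀ x, X x ∈ horizontal 𝓘(ℝ, E) 𝓘(ℝ, E') F x) : vert 𝓘(ℝ, E) 𝓘(ℝ, E') F X = 0 :=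
  funext fun x => (Submodule.starProjection_apply_eq_zero_iff _).2 (hX x)

theorem vert_eq_self {F : M → N} {X : Π x : M, TangentSpace 𝓘(ℝ, E) x}
    (hX : ∀ x, X x ∈ vertical 𝓘(ℝ, E) 𝓘(ℝ, E') F x) : vert 𝓘(ℝ, E) 𝓘(ℝ, E') F X = X :=
  funext fun x => Submodule.starProjection_eq_self_iff.2 (hX x)

theorem hor_eq_zero {F : M → N} {X : Π x : M, TangentSpace 𝓘(ℝ, E) x}
    (hX : ∀ x, X x ∈ vertical 𝓘(ℝ, E) 𝓘(ℝ, E') F x) : hor 𝓘(ℝ, E) 𝓘(ℝ, E') F X = 0 :=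
  funext fun x => (Submodule.starProjection_apply_eq_zero_iff _).2
    (Submodule.le_orthogonal_orthogonal _ (hX x))

theorem hor_zero (F : M → N) :
    hor 𝓘(ℝ, E) 𝓘(ℝ, E') F (0 : Π x : M, TangentSpace 𝓘(ℝ, E) x) = 0 :=
  funext fun _ => map_zero _

theorem vert_zero (F : M → N) :
    vert 𝓘(ℝ, E) 𝓘(ℝ, E') F (0 : Π x : M, TangentSpace 𝓘(ℝ, E) x) = 0 :=
  funext fun _ => map_zero _

theorem tensorA_of_horizontal {F : M → N} {X Y : Π x : M, TangentSpace 𝓘(ℝ, E) x}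
    (hX : ∀ x, X x ∈ horizontal 𝓘(ℝ, E) 𝓘(ℝ, E') F x)
    (hY : ∀ x, Y x ∈ horizontal 𝓘(ℝ, E) 𝓘(ℝ, E') F x) :
    tensorA 𝓘(ℝ, E) 𝓘(ℝ, E') F X Y = vert 𝓘(ℝ, E) 𝓘(ℝ, E') F (nabla X Y) := by
  rw [tensorA, hor_eq_self hX, hor_eq_self hY, vert_eq_zero hY, nabla_zero_right, hor_zero,
    zero_add]

theorem tensorA_of_vertical {F : M → N} {X Y : Π x : M, TangentSpace 𝓘(ℝ, E) x}
    (hX : ∀ x, X x ∈ horizontal 𝓘(ℝ, E) 𝓘(ℝ, E') F x)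
    (hY : ∀ x, Y x ∈ vertical 𝓘(ℝ, E) 𝓘(ℝ, E') F x) :
    tensorA 𝓘(ℝ, E) 𝓘(ℝ, E') F X Y = hor 𝓘(ℝ, E) 𝓘(ℝ, E') F (nabla X Y) := by
  rw [tensorA, hor_eq_self hX, hor_eq_zero hY, vert_eq_self hY, nabla_zero_right, vert_zero,
    add_zero]

theorem IsAlmostHermitian.contMDiff_apply {J : Π x : M, TangentSpace 𝓘(ℝ, E) x →L[ℝ]
    TangentSpace 𝓘(ℝ, E) x} (hJ : IsAlmostHermitian J) {X : Π x : M, TangentSpace 𝓘(ℝ, E) x}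
    (hX : ContMDiff 𝓘(ℝ, E) 𝓘(ℝ, E).tangent ∞ (fun x => (X x : TangentBundle 𝓘(ℝ, E) M))) :
    ContMDiff 𝓘(ℝ, E) 𝓘(ℝ, E).tangent ∞ (fun x => (J x (X x) : TangentBundle 𝓘(ℝ, E) M)) :=
  ContMDiff.clm_bundle_apply (F₁ := E) (F₂ := E) (E₁ := fun x : M => TangentSpace 𝓘(ℝ, E) x)
    (E₂ := fun x : M => TangentSpace 𝓘(ℝ, E) x) hJ.smooth hX

theorem IsAlmostHermitian.apply_mem_orthogonal_iff {J : Π x : M, TangentSpace 𝓘(ℝ, E) x →L[ℝ]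
    TangentSpace 𝓘(ℝ, E) x} (hJ : IsAlmostHermitian J) {x : M}
    {D : Submodule ℝ (TangentSpace 𝓘(ℝ, E) x)}
    (hD : D.map (J x : TangentSpace 𝓘(ℝ, E) x →ₗ[ℝ] TangentSpace 𝓘(ℝ, E) x) = D)
    (w : TangentSpace 𝓘(ℝ, E) x) : J x w ∈ Dᗮ ↔ w ∈ Dᗮ := by
  simp only [Submodule.mem_orthogonal]
  constructor
  · intro h d hd
    rw [← hJ.inner_map]
    exact h _ (hD ▸ Submodule.mem_map_of_mem hd)
  · intro h d hd
    rw [← hD] at hd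
    obtain ⟨d', hd', rfl⟩ := hd
    exact (hJ.inner_map x d' w).trans (h d' hd')

/-- `∇_X (B Y) + ∇_X (C Y) = J ∇_X Y`. -/
theorem nabla_opB_add_nabla_opC {J : Π x : M, TangentSpace 𝓘(ℝ, E) x →L[ℝ]
    TangentSpace 𝓘(ℝ, E) x} (hJ : IsKahler J) {F : M → N}
    (hF : ContMDiff 𝓘(ℝ, E) 𝓘(ℝ, E') ∞ F)
    (hsub : ∀ x, Function.Surjective (mfderiv 𝓘(ℝ, E) 𝓘(ℝ, E') F x))
    {X Y : Π x : M, TangentSpace 𝓘(ℝ, E) x}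
    (hX : ContMDiff 𝓘(ℝ, E) 𝓘(ℝ, E).tangent ∞ (fun x => (X x : TangentBundle 𝓘(ℝ, E) M)))
    (hY : ContMDiff 𝓘(ℝ, E) 𝓘(ℝ, E).tangent ∞ (fun x => (Y x : TangentBundle 𝓘(ℝ, E) M)))
    (x : M) :
    nabla X (opB 𝓘(ℝ, E) 𝓘(ℝ, E') F J Y) x + nabla X (opC 𝓘(ℝ, E) 𝓘(ℝ, E') F J Y) x =
      J x (nabla X Y x) := by
  have hJY : MDiffAt (T% (fun x => J x (Y x))) x :=
    (hJ.toIsAlmostHermitian.contMDiff_apply hY).contMDiffAt.mdifferentiableAt (by simp)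
  have h := (leviCivita 𝓘(ℝ, E) M).isCovariantDerivativeOnUniv.add
    (mdifferentiableAt_hor hF (hsub x) hJY) (mdifferentiableAt_vert hF (hsub x) hJY)
  rw [hor_add_vert] at h
  rw [← hJ.parallel X Y hX hY, nabla, nabla, nabla, h, add_comm]
  rfl

theorem IsRiemannianSubmersion.tensorA_eq_zero_iff
    [RiemannianBundle (fun y : N => TangentSpace 𝓘(ℝ, E') y)]
    [IsContMDiffRiemannianBundle 𝓘(ℝ, E') ∞ E' (fun y : N => TangentSpace 𝓘(ℝ, E') y)]
    {F : M → N} (hF : IsRiemannianSubmersion 𝓘(ℝ, E) 𝓘(ℝ, E') F)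
    {X Y : Π x : M, TangentSpace 𝓘(ℝ, E) x} (hX : ∀ x, MDiffAt (T% X) x)
    (hY : ∀ x, MDiffAt (T% Y) x)
    (hXh : ∀ x, X x ∈ horizontal 𝓘(ℝ, E) 𝓘(ℝ, E') F x)
    (hYh : ∀ x, Y x ∈ horizontal 𝓘(ℝ, E) 𝓘(ℝ, E') F x) :
    tensorA 𝓘(ℝ, E) 𝓘(ℝ, E') F X Y = 0 ↔
      ∀ x, mlieBracket 𝓘(ℝ, E) X Y x ∈ horizontal 𝓘(ℝ, E) 𝓘(ℝ, E') F x := by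
  rw [tensorA_of_horizontal hXh hYh, funext_iff]
  refine forall_congr' fun x => ?_
  refine (Submodule.starProjection_apply_eq_zero_iff _).trans ?_
  rw [horizontal, Submodule.mem_orthogonal', Submodule.mem_orthogonal']
  refine forall₂_congr fun u hu => ?_
  rw [← hF.two_mul_inner_nabla (hX x) (hY x) hXh hYh hu]
  simp

theorem projP_eq_zero_iff {J : Π x : M, TangentSpace 𝓘(ℝ, E) x →L[ℝ]
    TangentSpace 𝓘(ℝ, E) x} (hJ : IsKahler J) {F : M → N}
    (hF : ContMDiff 𝓘(ℝ, E) 𝓘(ℝ, E') ∞ F)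
    (hsub : ∀ x, Function.Surjective (mfderiv 𝓘(ℝ, E) 𝓘(ℝ, E') F x))
    {D₁ : Π x : M, Submodule ℝ (TangentSpace 𝓘(ℝ, E) x)}
    (hle : ∀ x, D₁ x ≤ horizontal 𝓘(ℝ, E) 𝓘(ℝ, E') F x)
    (hinv : ∀ x, (D₁ x).map (J x : TangentSpace 𝓘(ℝ, E) x →ₗ[ℝ] TangentSpace 𝓘(ℝ, E) x) = D₁ x)
    {X Y : Π x : M, TangentSpace 𝓘(ℝ, E) x}
    (hX : ContMDiff 𝓘(ℝ, E) 𝓘(ℝ, E).tangent ∞ (fun x => (X x : TangentBundle 𝓘(ℝ, E) M)))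
    (hY : ContMDiff 𝓘(ℝ, E) 𝓘(ℝ, E).tangent ∞ (fun x => (Y x : TangentBundle 𝓘(ℝ, E) M)))
    (hXh : ∀ x, X x ∈ horizontal 𝓘(ℝ, E) 𝓘(ℝ, E') F x)
    (hYh : ∀ x, Y x ∈ horizontal 𝓘(ℝ, E) 𝓘(ℝ, E') F x) :
    projP D₁
      ((tensorA 𝓘(ℝ, E) 𝓘(ℝ, E') F X (opB 𝓘(ℝ, E) 𝓘(ℝ, E') F J Y)
          - tensorA 𝓘(ℝ, E) 𝓘(ℝ, E') F Y (opB 𝓘(ℝ, E) 𝓘(ℝ, E') F J X))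
        + hor 𝓘(ℝ, E) 𝓘(ℝ, E') F
          (nabla X (opC 𝓘(ℝ, E) 𝓘(ℝ, E') F J Y)
            - nabla Y (opC 𝓘(ℝ, E) 𝓘(ℝ, E') F J X))) = 0 ↔
      ∀ x, mlieBracket 𝓘(ℝ, E) X Y x ∈ (D₁ x)ᗮ := by
  have hB : ∀ (Z : Π x : M, TangentSpace 𝓘(ℝ, E) x) (x : M),
      opB 𝓘(ℝ, E) 𝓘(ℝ, E') F J Z x ∈ vertical 𝓘(ℝ, E) 𝓘(ℝ, E') F x := fun Z x =>
    Submodule.starProjection_apply_mem _ _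
  rw [tensorA_of_vertical hXh (hB Y), tensorA_of_vertical hYh (hB X), funext_iff]
  refine forall_congr' fun x => ?_
  have hbr : hor 𝓘(ℝ, E) 𝓘(ℝ, E') F (nabla X (opB 𝓘(ℝ, E) 𝓘(ℝ, E') F J Y)) x
        - hor 𝓘(ℝ, E) 𝓘(ℝ, E') F (nabla Y (opB 𝓘(ℝ, E) 𝓘(ℝ, E') F J X)) x
        + hor 𝓘(ℝ, E) 𝓘(ℝ, E') F (nabla X (opC 𝓘(ℝ, E) 𝓘(ℝ, E') F J Y)
            - nabla Y (opC 𝓘(ℝ, E) 𝓘(ℝ, E') F J X)) x =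
      (horizontal 𝓘(ℝ, E) 𝓘(ℝ, E') F x).starProjection (J x (mlieBracket 𝓘(ℝ, E) X Y x)) := by
    rw [← leviCivita_torsionFree (hX.contMDiffAt.mdifferentiableAt (by simp))
        (hY.contMDiffAt.mdifferentiableAt (by simp)), map_sub,
      ← nabla_opB_add_nabla_opC hJ hF hsub hX hY, ← nabla_opB_add_nabla_opC hJ hF hsub hY hX]
    simp only [hor, Pi.sub_apply, map_add, map_sub]
    abel
  have hP : ∀ w : TangentSpace 𝓘(ℝ, E) x, (D₁ x).starProjection
      ((horizontal 𝓘(ℝ, E) 𝓘(ℝ, E') F x).starProjection w) = 0 ↔ w ∈ (D₁ x)ᗮ := fun w => by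
    have hd : w - (horizontal 𝓘(ℝ, E) 𝓘(ℝ, E') F x).starProjection w ∈ (D₁ x)ᗮ :=
      Submodule.orthogonal_le (hle x) (Submodule.sub_starProjection_mem_orthogonal w)
    rw [Submodule.starProjection_apply_eq_zero_iff]
    exact ⟨fun h => by simpa using Submodule.add_mem _ hd h,
      fun h => by simpa using Submodule.sub_mem _ h hd⟩
  rw [← hJ.toIsAlmostHermitian.apply_mem_orthogonal_iff (hinv x), ← hP, ← hbr]
  rfl

end SlantDistribution

end VSemiSlant

end

theorem lemma3p7
    {E : Type*} [NormedAddCommGroup E] [NormedSpace ℝ E] [FiniteDimensional ℝ E]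
    {M : Type*} [TopologicalSpace M] [T2Space M] [SecondCountableTopology M]
    [ChartedSpace E M] [IsManifold 𝓘(ℝ, E) ∞ M]
    [RiemannianBundle (fun x : M => TangentSpace 𝓘(ℝ, E) x)]
    [IsContMDiffRiemannianBundle 𝓘(ℝ, E) ∞ E (fun x : M => TangentSpace 𝓘(ℝ, E) x)]
    {E' : Type*} [NormedAddCommGroup E'] [NormedSpace ℝ E'] [FiniteDimensional ℝ E']
    {N : Type*} [TopologicalSpace N] [T2Space N] [SecondCountableTopology N]
    [ChartedSpace E' N] [IsManifold 𝓘(ℝ, E') ∞ N]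
    [RiemannianBundle (fun y : N => TangentSpace 𝓘(ℝ, E') y)]
    [IsContMDiffRiemannianBundle 𝓘(ℝ, E') ∞ E' (fun y : N => TangentSpace 𝓘(ℝ, E') y)]
    (J : Π x : M, TangentSpace 𝓘(ℝ, E) x →L[ℝ] TangentSpace 𝓘(ℝ, E) x)
    (hJ : IsKahler J)
    (F : M → N)
    (D₁ : Π x : M, Submodule ℝ (TangentSpace 𝓘(ℝ, E) x))
    (hF : IsVSemiSlantSubmersion 𝓘(ℝ, E) 𝓘(ℝ, E') J F D₁) :
    IsIntegrable (complementIn 𝓘(ℝ, E) 𝓘(ℝ, E') F D₁) ↔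
      ∀ X Y : Π x : M, TangentSpace 𝓘(ℝ, E) x,
        IsSectionOf X (complementIn 𝓘(ℝ, E) 𝓘(ℝ, E') F D₁) →
        IsSectionOf Y (complementIn 𝓘(ℝ, E) 𝓘(ℝ, E') F D₁) →
          tensorA 𝓘(ℝ, E) 𝓘(ℝ, E') F X Y = 0 ∧
          projP D₁
            ((tensorA 𝓘(ℝ, E) 𝓘(ℝ, E') F X (opB 𝓘(ℝ, E) 𝓘(ℝ, E') F J Y)
                - tensorA 𝓘(ℝ, E) 𝓘(ℝ, E') F Y (opB 𝓘(ℝ, E) 𝓘(ℝ, E') F J X))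
              + hor 𝓘(ℝ, E) 𝓘(ℝ, E') F
                (nabla X (opC 𝓘(ℝ, E) 𝓘(ℝ, E') F J Y)
                  - nabla Y (opC 𝓘(ℝ, E) 𝓘(ℝ, E') F J X))) = 0 := by
  have hs := hF.toIsRiemannianSubmersion
  refine forall₂_congr fun X Y => forall₂_congr fun hX hY => ?_
  have hXh : ∀ x, X x ∈ horizontal 𝓘(ℝ, E) 𝓘(ℝ, E') F x := fun x => (hX.mem x).2
  have hYh : ∀ x, Y x ∈ horizontal 𝓘(ℝ, E) 𝓘(ℝ, E') F x := fun x => (hY.mem x).2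
  rw [hs.tensorA_eq_zero_iff (fun x => hX.smooth.contMDiffAt.mdifferentiableAt (by simp))
      (fun x => hY.smooth.contMDiffAt.mdifferentiableAt (by simp)) hXh hYh,
    projP_eq_zero_iff hJ hs.smooth hs.submersion hF.le_horizontal hF.invariant hX.smooth hY.smooth
      hXh hYh, and_comm, ← forall_and]
  rfl
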